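/- **Theorem.** Let $\mathbb N_0^\times$ be the multiplicative monoid of non-negative integers, regarded as a category with one object $*$, and let $\widehat{\mathbb N_0^\times}$ be the topos of presheaves of sets on it. For a subgroup $H\subset\mathbb Q$ let $H^+=\{q\in H: q\ge 0\}$, regarded as a functor $\mathbb N_0^\times\to\mathrm{Sets}$ through multiplication by non-negative integers. For a prime $p$ let $H(p)=\mathbb Z[1/p]\subset\mathbb Q$ be the group of fractions whose denominator is a power of $p$, and let $H(\eta)=\{0\}$ for the generic point $\eta$ of $\operatorname{Spec}\mathbb Z$. Let $\mathcal S$ be the sheaf of sets on $\operatorname{Spec}\mathbb Z$ (Zariski topology) whose sections over an open set $U$ are the families $(\xi_x)_{x\in U}$ with $\xi_x\in H(x)^+$ and $\xi_x\ne0$ for only finitely many $x\in U$, with the obvious restriction maps; $\mathbb N_0^\times$ acts on $\mathcal S$ by $(n\xi)_x=n\xi_x$. For every point $x$, evaluation at $x$ identifies the stalk $\mathcal S_x$, with its action of $\mathbb N_0^\times$, with $H(x)^+$. The functor $F:\mathbb N_0^\times\to\mathrm{Sh}(\operatorname{Spec}\mathbb Z)$ which sends $*$ to $\mathcal S$ and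 the endomorphisms of $*$ to the action of $\mathbb N_0^\times$ on $\mathcal S$ is filtering, that is: 1. the map $F(*)\to 1$ is an epimorphism; 2. the family of all maps $(F(u),F(v)):F(*)\to F(*)\times F(*)$, $u,v\in\mathbb N_0^\times$, is epimorphic; 3. for all $u,v\in\mathbb N_0^\times$, the family of maps from $F(*)$ to the equalizer of $F(u),F(v)$ induced by the $F(w)$ with $uw=vw$ is epimorphic. Moreover $F$ is flat, i.e. the functor $-\otimes_{\mathbb N_0^\times}F:\widehat{\mathbb N_0^\times}\to\mathrm{Sh}(\operatorname{Spec}\mathbb Z)$ (the left Kan extension of $F$ along the Yoneda embedding) preserves finite limits. Hence $F$ defines a geometric morphism $\Theta:\mathrm{Sh}(\operatorname{Spec}\mathbb Z)\to\widehat{\mathbb N_0^\times}$ with inverse image $\Theta^*=-\otimes_{\mathbb N_0^\times}F$ and direct image $\Theta_*=\mathrm{Hom}(F(-),-)$. A geometric morphism $f:\mathrm{Sh}(\operatorname{Spec}\mathbb Z)\to\widehat{\mathbb N_0^\times}$ is isomorphic to $\Theta$ if and only if the restriction of $f^*$ along the Yoneda embedding is isomorphic to $F$. For every prime $p$, the functor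 $H(p)^+:\mathbb N_0^\times\to\mathrm{Sets}$ is flat, and the image under $\Theta$ of the point $p$ of $\operatorname{Spec}\mathbb Z$ (the composite of $\Theta$ with the point of $\mathrm{Sh}(\operatorname{Spec}\mathbb Z)$ given by the stalk functor at $p$) is isomorphic to the point of $\widehat{\mathbb N_0^\times}$ defined by $H(p)^+$. Likewise $\{0\}^+$ is flat, and the image under $\Theta$ of the generic point is isomorphic to the base point of $\widehat{\mathbb N_0^\times}$, i.e. the point defined by the subgroup $\{0\}\subset\mathbb Q$. -/

import Mathlib

open CategoryTheory CategoryTheory.Limits TopologicalSpace Opposite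

universe v u₁ u₂ u₃

/-! ### Geometric morphisms, filtering functors, flat functors -/

/-- A geometric morphism `ℰ ⟶ ℱ`: a direct image functor `ℰ ⥤ ℱ` together with a left adjoint
(the inverse image functor) which preserves finite limits. -/
structure GeomMorphism (ℰ : Type u₁) [Category.{v} ℰ] (ℱ : Type u₂) [Category.{v} ℱ] where
  inverseImage : ℱ ⥤ ℰ
  directImage : ℰ ⥤ ℱ
  adj : inverseImage ⊣ directImage
  leftExact : PreservesFiniteLimits inverseImage

namespace GeomMorphism

variable {ℰ : Type u₁} [Category.{v} ℰ] {ℱ : Type u₂} [Category.{v} ℱ]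
  {𝒢 : Type u₃} [Category.{v} 𝒢]

/-- The composite `ℰ ⟶ ℱ ⟶ 𝒢` of two geometric morphisms. -/
def comp (f : GeomMorphism ℰ ℱ) (g : GeomMorphism ℱ 𝒢) : GeomMorphism ℰ 𝒢 where
  inverseImage := g.inverseImage ⋙ f.inverseImage
  directImage := f.directImage ⋙ g.directImage
  adj := g.adj.comp f.adj
  leftExact :=
    have := f.leftExact
    have := g.leftExact
    comp_preservesFiniteLimits _ _

/-- Two geometric morphisms are isomorphic when their inverse image functors are
(equivalently, by adjunction, when their direct image functors are). -/
def Isomorphic (f g : GeomMorphism ℰ ℱ) : Prop :=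
  Nonempty (f.inverseImage ≅ g.inverseImage)

end GeomMorphism

/-- A family of morphisms `f i : A i ⟶ B` is epimorphic if two morphisms out of `B` which agree
after composition with every `f i` are equal. -/
def IsEpimorphicFamily {ℰ : Type u₁} [Category.{v} ℰ] {ι : Sort*} {A : ι → ℰ} {B : ℰ}
    (f : ∀ i, A i ⟶ B) : Prop :=
  ∀ ⦃Z : ℰ⦄ (g h : B ⟶ Z), (∀ i, f i ≫ g = f i ≫ h) → g = h

/-- A functor `A : C ⥤ ℰ` from a small category to a topos is filtering if
* the family of all maps `A c ⟶ 1` is epimorphic;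
* for all `c`, `d`, the family of all maps `(A u, A v) : A b ⟶ A c × A d`, for
  `u : b ⟶ c` and `v : b ⟶ d` in `C`, is epimorphic;
* for all `u v : c ⟶ d`, the family of all maps `A b ⟶ Eq(A u, A v)` induced by the
  `w : b ⟶ c` with `u ∘ w = v ∘ w` is epimorphic. -/
structure IsFiltering {C : Type u₁} [Category.{v} C] {ℰ : Type u₂} [Category.{v} ℰ]
    [HasFiniteLimits ℰ] (A : C ⥤ ℰ) : Prop where
  nonempty : IsEpimorphicFamily fun c : C ↦ terminal.from (A.obj c)
  pair (c d : C) : IsEpimorphicFamily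
    fun i : (b : C) × (b ⟶ c) × (b ⟶ d) ↦ prod.lift (A.map i.2.1) (A.map i.2.2)
  parallel {c d : C} (s t : c ⟶ d) : IsEpimorphicFamily
    fun i : (b : C) × {w : b ⟶ c // w ≫ s = w ≫ t} ↦
      equalizer.lift (f := A.map s) (g := A.map t) (A.map i.2.1)
        (by rw [← A.map_comp, ← A.map_comp, i.2.2])

section Flat

variable {C : Type v} [SmallCategory C] {ℰ : Type u₂} [Category.{v} ℰ] [HasColimits ℰ]

/-- The tensor product functor `P ↦ P ⊗_C A` from presheaves on `C` to `ℰ`, i.e. the left Kan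
extension of `A` along the Yoneda embedding; it is left adjoint to
`E ↦ (c ↦ Hom (A c, E))`. (`uliftYoneda.{v}` is the Yoneda embedding of `C`, up to a `ULift`
which does not change the universe.) -/
noncomputable abbrev tensorFunctor (A : C ⥤ ℰ) : (Cᵒᵖ ⥤ Type v) ⥤ ℰ :=
  uliftYoneda.{v}.leftKanExtension A

/-- A functor from a small category to a topos is flat if tensoring with it preserves finite
limits. -/
def IsFlat (A : C ⥤ ℰ) : Prop :=
  PreservesFiniteLimits (tensorFunctor A)

/-- The geometric morphism from `ℰ` to the presheaf topos of `C` defined by a flat functor `A`: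
its inverse image is `P ↦ P ⊗_C A` and its direct image is `E ↦ (c ↦ Hom (A c, E))`. -/
noncomputable def GeomMorphism.ofFlat (A : C ⥤ ℰ) (hA : IsFlat A) :
    GeomMorphism ℰ (Cᵒᵖ ⥤ Type v) where
  inverseImage := tensorFunctor A
  directImage := Presheaf.restrictedULiftYoneda.{v} A
  adj := Presheaf.uliftYonedaAdjunction.{v} _ (uliftYoneda.{v}.leftKanExtensionUnit A)
  leftExact := hA

end Flat

/-! ### The topos of sheaves of sets on a topological space, and its points -/

instance sheaf_hasFiniteLimits (X : TopCat.{0}) : HasFiniteLimits (TopCat.Sheaf Type X) :=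
  inferInstanceAs (HasFiniteLimits (CategoryTheory.Sheaf (Opens.grothendieckTopology X) Type))

instance sheaf_hasColimits (X : TopCat.{0}) : HasColimits (TopCat.Sheaf Type X) :=
  inferInstanceAs (HasColimits (CategoryTheory.Sheaf (Opens.grothendieckTopology X) Type))

/-- The functor sending a sheaf of sets on `X` to its stalk at `x`. -/
noncomputable abbrev stalkAt {X : TopCat.{0}} (x : X) : TopCat.Sheaf Type X ⥤ Type :=
  TopCat.Sheaf.forget Type X ⋙ TopCat.Presheaf.stalkFunctor Type x

theorem stalkAt_preservesFiniteLimits {X : TopCat.{0}} (x : X) :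
    PreservesFiniteLimits (stalkAt x) :=
  comp_preservesFiniteLimits
    (CategoryTheory.sheafToPresheaf (Opens.grothendieckTopology X) Type)
    ((Functor.whiskeringLeft (OpenNhds x)ᵒᵖ (Opens X)ᵒᵖ Type).obj
      (OpenNhds.inclusion x).op ⋙ colim)

open Classical in
/-- The point of the topos of sheaves on `X` given by `x : X`: the inverse image is the
stalk functor at `x` and the direct image is the skyscraper sheaf functor. -/
noncomputable def pointOfSpace {X : TopCat.{0}} (x : X) :
    GeomMorphism Type (TopCat.Sheaf Type X) where
  inverseImage := stalkAt x
  directImage := skyscraperSheafFunctor x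
  adj := stalkSkyscraperSheafAdjunction x
  leftExact := stalkAt_preservesFiniteLimits x

/-! ### The monoid `ℕ₀ˣ` and the sets with action attached to subgroups of `ℚ` -/

/-- The category with one object whose monoid of endomorphisms is the multiplicative monoid of
non-negative integers. -/
abbrev NZeroTimes : Type := SingleObj ℕ

/-- The unique object of `NZeroTimes`. -/
abbrev NZeroTimes.pt : NZeroTimes := SingleObj.star ℕ

/-- The non-negative part of a subgroup `H` of `ℚ`. -/
def nonnegPart (H : AddSubgroup ℚ) : AddSubmonoid ℚ where
  carrier := {q | q ∈ H ∧ 0 ≤ q}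
  add_mem' ha hb := ⟨H.add_mem ha.1 hb.1, add_nonneg ha.2 hb.2⟩
  zero_mem' := ⟨H.zero_mem, le_rfl⟩

/-- The functor from `NZeroTimes` to sets given by the non-negative part of a subgroup `H` of `ℚ`,
on which the non-negative integers act by multiplication. -/
def nonnegFunctor (H : AddSubgroup ℚ) : NZeroTimes ⥤ Type where
  obj _ := nonnegPart H
  map n := ↾fun q ↦ (show ℕ from n) • q
  map_id _ := by
    ext q
    exact congrArg Subtype.val (one_nsmul q)
  map_comp m n := by
    ext q
    exact congrArg Subtype.val (mul_nsmul' q n m)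

/-- The group `H(p) = ℤ[1/p]` of fractions whose denominator is a power of `p`. -/
def fractionGroup (p : ℕ) : AddSubgroup ℚ where
  carrier := {q | ∃ (k : ℕ) (a : ℤ), q * (p : ℚ) ^ k = a}
  add_mem' := by
    rintro q r ⟨k, a, hq⟩ ⟨l, b, hr⟩
    refine ⟨k + l, a * p ^ l + b * p ^ k, ?_⟩
    push_cast
    rw [← hq, ← hr]
    ring
  zero_mem' := ⟨0, 0, by simp⟩
  neg_mem' := by
    rintro q ⟨k, a, hq⟩
    exact ⟨k, -a, by push_cast; rw [← hq]; ring⟩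

/-! ### The spectrum of `ℤ` and the sheaf `𝒮` -/

/-- `Spec ℤ` with its Zariski topology. -/
abbrev SpecZ : TopCat.{0} := TopCat.of (PrimeSpectrum ℤ)

/-- The point of `Spec ℤ` given by a rational prime. -/
def primePoint (p : Nat.Primes) : SpecZ :=
  (⟨Ideal.span {((p : ℕ) : ℤ)},
    (Ideal.span_singleton_prime (by exact_mod_cast p.2.ne_zero)).2
      (Nat.prime_iff_prime_int.1 p.2)⟩ : PrimeSpectrum ℤ)

/-- The generic point of `Spec ℤ`. -/
def genericPointZ : SpecZ := (⊥ : PrimeSpectrum ℤ)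

open Classical in
/-- The subgroup of `ℚ` attached to a point of `Spec ℤ`: it is `{0}` at the generic point, and
`H(p)` at the point given by a prime `p` (which is the absolute norm of the ideal `(p)`);
see `pointGroup_generic` and `pointGroup_prime`. -/
noncomputable def pointGroup (x : SpecZ) : AddSubgroup ℚ :=
  if x = genericPointZ then ⊥ else fractionGroup (Ideal.absNorm (PrimeSpectrum.asIdeal x))

theorem pointGroup_generic : pointGroup genericPointZ = ⊥ := if_pos rfl

theorem primePoint_ne_generic (p : Nat.Primes) : primePoint p ≠ genericPointZ := by
  intro h
  have h' : Ideal.span {((p : ℕ) : ℤ)} = ⊥ := congrArg PrimeSpectrum.asIdeal h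
  rw [Ideal.span_singleton_eq_bot] at h'
  exact p.2.ne_zero (by exact_mod_cast h')

theorem pointGroup_prime (p : Nat.Primes) : pointGroup (primePoint p) = fractionGroup p := by
  rw [pointGroup, if_neg (primePoint_ne_generic p)]
  have : Ideal.absNorm (Ideal.span {((p : ℕ) : ℤ)}) = p := by
    rw [Ideal.absNorm_span_singleton]; simp
  exact congrArg fractionGroup this

theorem genericPointZ_mem {U : Opens SpecZ} {x : SpecZ} (hx : x ∈ U) : genericPointZ ∈ U :=
  (PrimeSpectrum.le_iff_specializes (⊥ : PrimeSpectrum ℤ) x |>.1 bot_le).mem_open U.2 hx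

theorem finite_compl_of_mem {U : Opens SpecZ} (hU : genericPointZ ∈ U) :
    {x : SpecZ | x ∉ U}.Finite := by
  obtain ⟨s, hs⟩ := (PrimeSpectrum.isOpen_iff (U : Set (PrimeSpectrum ℤ))).1 U.2
  obtain ⟨n, hn, hn0⟩ : ∃ n ∈ s, n ≠ (0 : ℤ) := by
    by_contra! hcon
    have : genericPointZ ∈ (U : Set SpecZ)ᶜ := by
      rw [hs]
      exact fun n hn ↦ hcon n hn
    exact this hU
  have hfin : {I : Ideal ℤ | Ideal.span {n} ≤ I}.Finite := by
    have hne : Ideal.span {n} ≠ ⊥ := by rwa [Ne, Ideal.span_singleton_eq_bot]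
    have hft := UniqueFactorizationMonoid.fintypeSubtypeDvd (Ideal.span {n}) hne
    have hset : {I : Ideal ℤ | Ideal.span {n} ≤ I} = {I | I ∣ Ideal.span {n}} := by
      ext I
      exact Ideal.dvd_iff_le.symm
    rw [hset]
    exact Set.finite_coe_iff.1 (@Finite.of_fintype _ hft)
  refine Set.Finite.of_injOn (f := fun x : SpecZ ↦ PrimeSpectrum.asIdeal x) ?_ ?_ hfin
  · intro x hx
    have hx' : x ∈ (U : Set SpecZ)ᶜ := hx
    rw [hs] at hx'
    exact (Ideal.span_singleton_le_iff_mem _).2 (hx' hn)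
  · intro x _ y _ hxy
    exact PrimeSpectrum.ext hxy

/-- The condition, on a family `ξ` of elements `ξ x` of the non-negative parts of the groups
attached to the points `x` of an open subset `U` of `Spec ℤ`, that `ξ x ≠ 0` for only finitely
many `x` in `U`. This condition is local. -/
def finitelySupported : TopCat.LocalPredicate (X := SpecZ) fun x ↦ nonnegPart (pointGroup x) where
  pred {U} ξ := {x : U | ξ x ≠ 0}.Finite
  res {U V} i ξ h := by
    refine Set.Finite.of_injOn (f := fun x : U ↦ (⟨x, i.le x.2⟩ : V)) (fun x hx ↦ hx) ?_ h
    intro x _ y _ hxy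
    exact Subtype.ext (congrArg (fun z : V ↦ (z : SpecZ)) hxy)
  locality {U} ξ h := by
    by_cases hU : genericPointZ ∈ U
    · obtain ⟨V, hV, i, hfin⟩ := h ⟨genericPointZ, hU⟩
      refine ((hfin.image fun x : V ↦ (⟨x, i.le x.2⟩ : U)).union
        ((finite_compl_of_mem hV).preimage Subtype.val_injective.injOn)).subset ?_
      intro x hx
      by_cases hxV : (x : SpecZ) ∈ V
      · exact Or.inl ⟨⟨x, hxV⟩, hx, rfl⟩
      · exact Or.inr hxV
    · have : IsEmpty U := ⟨fun x ↦ hU (genericPointZ_mem x.2)⟩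
      exact Set.toFinite _

/-- The sheaf `𝒮` on `Spec ℤ`: its sections over `U` are the families `ξ` of elements
`ξ x ∈ H(x)⁺`, for `x ∈ U`, such that `ξ x ≠ 0` for only finitely many `x`, where `H(x)` is
`ℤ[1/p]` at a prime `p` and `{0}` at the generic point. -/
noncomputable def sheafS : TopCat.Sheaf Type SpecZ :=
  TopCat.subsheafToTypes finitelySupported

/-- The endomorphism of `𝒮` given by pointwise multiplication by `n`: `(n ξ) x = n (ξ x)`. -/
noncomputable def mulS (n : ℕ) : sheafS ⟶ sheafS :=
  ⟨{ app := fun U ↦ ↾fun ξ : {ξ : ∀ x : U.unop, nonnegPart (pointGroup x) //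
        finitelySupported.pred ξ} ↦
          ⟨fun x ↦ n • ξ.1 x, ξ.2.subset fun x hx h0 ↦ hx (by
            change ξ.1 x = 0 at h0
            change n • ξ.1 x = 0
            rw [h0, smul_zero])⟩
     naturality := fun U V i ↦ rfl }⟩

/-- The functor from `NZeroTimes` to sheaves of sets on `Spec ℤ` given by `𝒮` together with the
action of the non-negative integers by multiplication. -/
noncomputable def functorS : NZeroTimes ⥤ TopCat.Sheaf Type SpecZ where
  obj _ := sheafS
  map n := mulS n
  map_id _ := by
    apply CategoryTheory.Sheaf.hom_ext
    ext U ξ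
    refine Subtype.ext (funext fun x ↦ ?_)
    exact one_nsmul (ξ.1 x)
  map_comp m n := by
    apply CategoryTheory.Sheaf.hom_ext
    ext U ξ
    refine Subtype.ext (funext fun x ↦ ?_)
    exact mul_nsmul' (ξ.1 x) n m

/-! ### Set-valued functors with cofiltered category of elements -/

section Elements

variable {C : Type v} [SmallCategory C]

/-! Everything is reduced to stalks. The points of a space are jointly conservative, and each stalk
functor preserves finite limits and colimits; so tensoring with a sheaf-valued functor is left
exact, and a family of maps is epimorphic, as soon as this holds on stalks
(`preservesFiniteLimits_of_comp_stalkAt`, `isEpimorphicFamily_of_stalkAt`). For a set-valued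
functor, both flatness and the filtering conditions follow from cofilteredness of its category of
elements.

The stalk of `sheafS` at `x` is `H(x)⁺`, because finite sets of closed points can be removed from a
neighbourhood (`stalkToFiber_finitelySupported_bijective`). The elements of `H⁺` form a cofiltered
category because any two elements of `H⁺` are multiples of a third, by Bézout
(`exists_nsmul_eq_and_nsmul_eq`), and because two distinct integers act equally only on `0`. The
images of points are then read off from stalks, since a colimit-preserving functor on presheaves is
determined by its values on representables. -/

theorem isCofiltered_elements_of_iso {A B : C ⥤ Type v} (e : A ≅ B) [IsCofiltered A.Elements] :
    IsCofiltered B.Elements :=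
  IsCofiltered.of_equivalence
    (((CategoryOfElements.structuredArrowEquivalence A).trans
      (StructuredArrow.mapNatIso e)).trans
        (CategoryOfElements.structuredArrowEquivalence B).symm)

/-- A set-valued functor whose category of elements is cofiltered, seen as a point of the site
given by the trivial topology. -/
noncomputable def pointOfCofilteredElements (A : C ⥤ Type v) [IsCofiltered A.Elements] :
    GrothendieckTopology.Point.{v} (⊥ : GrothendieckTopology C) where
  fiber := A
  initiallySmall :=
    have : EssentiallySmall.{v} A.Elements := essentiallySmallSelf.{v, v, v} _
    initiallySmall_of_essentiallySmall _
  jointly_surjective {U} R hR x := by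
    obtain rfl : R = ⊤ := by simpa using hR
    exact ⟨U, 𝟙 _, by simp, x, by simp⟩

/-- The presheaf fibre of the point above is a filtered colimit of evaluations, hence left exact. It
also preserves colimits and extends `A` along the Yoneda embedding, so it is the tensor functor. -/
theorem isFlat_of_isCofiltered_elements (A : C ⥤ Type v) [IsCofiltered A.Elements] :
    IsFlat A :=
  let Φ := pointOfCofilteredElements A
  let e : A ≅ uliftYoneda.{v} ⋙ Φ.presheafFiber :=
    Φ.shrinkYonedaCompPresheafFiberIso.symm ≪≫
      Functor.isoWhiskerRight uliftYonedaIsoShrinkYoneda.symm Φ.presheafFiber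
  preservesFiniteLimits_of_natIso
    (Presheaf.uniqueExtensionAlongULiftYoneda.{v} (A := A) Φ.presheafFiber e)

end Elements

/-! ### Tensor products and inverse images -/

section Tensor

variable {C : Type v} [SmallCategory C] {ℰ : Type u₂} [Category.{v} ℰ] [HasColimits ℰ]
  {ℱ : Type u₃} [Category.{v} ℱ] [HasColimits ℱ]

/-- The restriction of `P ↦ P ⊗_C A` to representable presheaves is `A`. -/
noncomputable def uliftYonedaCompTensorFunctor (A : C ⥤ ℰ) :
    uliftYoneda.{v} ⋙ tensorFunctor A ≅ A :=
  Presheaf.isExtensionAlongULiftYoneda.{v} A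

/-- A colimit-preserving functor commutes with tensor products. -/
noncomputable def tensorFunctorCompIso (A : C ⥤ ℰ) (L : ℰ ⥤ ℱ)
    [PreservesColimitsOfSize.{v, v} L] {B : C ⥤ ℱ} (e : A ⋙ L ≅ B) :
    tensorFunctor A ⋙ L ≅ tensorFunctor B :=
  have : PreservesColimitsOfSize.{v, v} (tensorFunctor A) :=
    Presheaf.preservesColimitsOfSize_leftKanExtension A
  Presheaf.uniqueExtensionAlongULiftYoneda (tensorFunctor A ⋙ L)
    (e.symm ≪≫ Functor.isoWhiskerRight (uliftYonedaCompTensorFunctor A).symm L ≪≫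
      Functor.associator _ _ _)

/-- An inverse image is a left adjoint, so it preserves colimits and is determined by its
restriction to representables. -/
theorem GeomMorphism.nonempty_iso_iff_isomorphic_ofFlat (A : C ⥤ ℰ) (hA : IsFlat A)
    (f : GeomMorphism ℰ (Cᵒᵖ ⥤ Type v)) :
    Nonempty (uliftYoneda.{v} ⋙ f.inverseImage ≅ A) ↔ f.Isomorphic (.ofFlat A hA) := by
  have : PreservesColimitsOfSize.{v, v} f.inverseImage := f.adj.leftAdjoint_preservesColimits
  exact ⟨fun ⟨e⟩ ↦ ⟨Presheaf.uniqueExtensionAlongULiftYoneda f.inverseImage e.symm⟩,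
    fun ⟨e⟩ ↦ ⟨Functor.isoWhiskerLeft _ e ≪≫ uliftYonedaCompTensorFunctor A⟩⟩

/-- The image of a geometric morphism under the one defined by a flat functor `A` is defined by
the inverse image of `A`. -/
theorem GeomMorphism.comp_ofFlat_isomorphic (f : GeomMorphism ℱ ℰ) {A : C ⥤ ℰ} (hA : IsFlat A)
    {B : C ⥤ ℱ} (hB : IsFlat B) (e : A ⋙ f.inverseImage ≅ B) :
    (f.comp (.ofFlat A hA)).Isomorphic (.ofFlat B hB) :=
  have : PreservesColimitsOfSize.{v, v} f.inverseImage := f.adj.leftAdjoint_preservesColimits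
  ⟨tensorFunctorCompIso A f.inverseImage e⟩

end Tensor

/-! ### Detecting properties on stalks -/

section Stalks

variable {X : TopCat.{0}}

instance (x : X) : PreservesFiniteLimits (stalkAt x) := stalkAt_preservesFiniteLimits x

instance (x : X) : PreservesColimitsOfSize.{0, 0} (stalkAt x) :=
  (pointOfSpace x).adj.leftAdjoint_preservesColimits

theorem isIso_of_isIso_stalkAt_map {F G : TopCat.Sheaf Type X} (f : F ⟶ G)
    (h : ∀ x : X, IsIso ((stalkAt x).map f)) : IsIso f :=
  have : ∀ x : X, IsIso ((TopCat.Presheaf.stalkFunctor Type x).map f.1) := h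
  TopCat.Presheaf.isIso_of_stalkFunctor_map_iso f

theorem hom_ext_stalkAt {F G : TopCat.Sheaf Type X} {f g : F ⟶ G}
    (h : ∀ x : X, (stalkAt x).map f = (stalkAt x).map g) : f = g := by
  apply CategoryTheory.Sheaf.hom_ext
  ext U s
  induction U with | op U
  refine TopCat.Presheaf.section_ext G U _ _ fun x hx ↦ ?_
  have := ConcreteCategory.congr_hom (h x) (F.presheaf.germ U x hx s)
  exact (TopCat.Presheaf.stalkFunctor_map_germ_apply U x hx f.1 s).symm.trans
    (this.trans (TopCat.Presheaf.stalkFunctor_map_germ_apply U x hx g.1 s))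

theorem preservesFiniteLimits_of_comp_stalkAt {D : Type u₁} [Category.{v} D] [HasFiniteLimits D]
    (L : D ⥤ TopCat.Sheaf Type X) (h : ∀ x : X, PreservesFiniteLimits (L ⋙ stalkAt x)) :
    PreservesFiniteLimits L where
  preservesFiniteLimits J _ _ := ⟨fun {K} ↦ by
    have : IsIso (limit.post K L) := isIso_of_isIso_stalkAt_map _ fun x ↦ by
      have := h x
      have hpost := limit.post_post K L (stalkAt x)
      have h₁ : IsIso (limit.post (K ⋙ L) (stalkAt x)) := inferInstance
      have h₂ : IsIso (limit.post K (L ⋙ stalkAt x)) := inferInstance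
      -- The stalk of the comparison map for `L`, followed by the comparison map of the stalk
      -- functor, is the comparison map of the composite; the last two are invertible, hence so is
      -- the first.
      exact @IsIso.of_isIso_fac_right _ _ _ _ _ _ _ _ h₁ h₂ hpost
    exact preservesLimit_of_isIso_post L K⟩

theorem isEpimorphicFamily_of_stalkAt {ι : Sort*} {A : ι → TopCat.Sheaf Type X}
    {B : TopCat.Sheaf Type X} (f : ∀ i, A i ⟶ B)
    (h : ∀ (x : X) (b : (stalkAt x).obj B), ∃ i a, (stalkAt x).map (f i) a = b) :
    IsEpimorphicFamily f := by
  intro Z g k hgk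
  refine hom_ext_stalkAt fun x ↦ ?_
  ext b
  obtain ⟨i, a, rfl⟩ := h x b
  have := ConcreteCategory.congr_hom (congrArg (stalkAt x).map (hgk i)) a
  rwa [Functor.map_comp, Functor.map_comp] at this

theorem prod_ext_of_preserves {D : Type u₁} [Category.{v} D] [HasFiniteLimits D] (L : D ⥤ Type v)
    [PreservesFiniteLimits L] {Y Z : D} {b b' : L.obj (Y ⨯ Z)}
    (h₁ : L.map prod.fst b = L.map prod.fst b') (h₂ : L.map prod.snd b = L.map prod.snd b') :
    b = b' := by
  refine Concrete.isLimit_ext _ (isLimitOfPreserves L (prodIsProd Y Z)) _ _ ?_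
  rintro ⟨_ | _⟩
  exacts [h₁, h₂]

theorem equalizer_ext_of_preserves {D : Type u₁} [Category.{v} D] [HasFiniteLimits D]
    (L : D ⥤ Type v) [PreservesFiniteLimits L] {Y Z : D} {s t : Y ⟶ Z}
    {b b' : L.obj (equalizer s t)} (h : L.map (equalizer.ι s t) b = L.map (equalizer.ι s t) b') :
    b = b' :=
  (mono_iff_injective (L.map (equalizer.ι s t))).1 inferInstance h

variable {C : Type} [SmallCategory C] (A : C ⥤ TopCat.Sheaf Type X)
  [∀ x : X, IsCofiltered (A ⋙ stalkAt x).Elements]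

theorem isFlat_of_isCofiltered_elements_stalkAt : IsFlat A :=
  preservesFiniteLimits_of_comp_stalkAt _ fun x ↦
    have : PreservesFiniteLimits (tensorFunctor (A ⋙ stalkAt x)) :=
      isFlat_of_isCofiltered_elements (A ⋙ stalkAt x)
    preservesFiniteLimits_of_natIso (tensorFunctorCompIso A (stalkAt x) (Iso.refl _)).symm

/-- Since stalks commute with finite limits, a stalk element of a product is a pair of elements, and
one of an equalizer is an element on which the two maps agree. A cone in the category of elements
provides the required preimage. -/
theorem isFiltering_of_isCofiltered_elements_stalkAt : IsFiltering A where
  nonempty := isEpimorphicFamily_of_stalkAt _ fun x b ↦ by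
    obtain ⟨c, a⟩ := (IsCofiltered.nonempty : Nonempty (A ⋙ stalkAt x).Elements)
    exact ⟨c, a, ((Types.isTerminalEquivUnique _
      (terminalIsTerminal.isTerminalObj (stalkAt x) _)).uniq _).trans
        ((Types.isTerminalEquivUnique _
          (terminalIsTerminal.isTerminalObj (stalkAt x) _)).uniq b).symm⟩
  pair c d := isEpimorphicFamily_of_stalkAt _ fun x b ↦ by
    obtain ⟨⟨e, a⟩, f, g, -⟩ := IsCofilteredOrEmpty.cone_objs
      ((A ⋙ stalkAt x).elementsMk c ((stalkAt x).map prod.fst b))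
      ((A ⋙ stalkAt x).elementsMk d ((stalkAt x).map prod.snd b))
    refine ⟨⟨e, f.1, g.1⟩, a, prod_ext_of_preserves (stalkAt x) ?_ ?_⟩
    · rw [← comp_apply, ← Functor.map_comp, prod.lift_fst]
      exact f.2
    · rw [← comp_apply, ← Functor.map_comp, prod.lift_snd]
      exact g.2
  parallel {c d} s t := isEpimorphicFamily_of_stalkAt _ fun x b ↦ by
    have hb : (A ⋙ stalkAt x).map s ((stalkAt x).map (equalizer.ι _ _) b) =
        (A ⋙ stalkAt x).map t ((stalkAt x).map (equalizer.ι (A.map s) (A.map t)) b) := by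
      have := congrArg (stalkAt x).map (equalizer.condition (A.map s) (A.map t))
      rw [Functor.map_comp, Functor.map_comp] at this
      exact ConcreteCategory.congr_hom this b
    let y := (A ⋙ stalkAt x).elementsMk c ((stalkAt x).map (equalizer.ι (A.map s) (A.map t)) b)
    let z := (A ⋙ stalkAt x).elementsMk d ((A ⋙ stalkAt x).map s y.2)
    obtain ⟨⟨e, a⟩, w, hw⟩ := IsCofilteredOrEmpty.cone_maps
      (CategoryOfElements.homMk y z s rfl) (CategoryOfElements.homMk y z t hb.symm)
    refine ⟨⟨e, w.1, congrArg Subtype.val hw⟩, a, equalizer_ext_of_preserves (stalkAt x) ?_⟩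
    rw [← comp_apply, ← Functor.map_comp, equalizer.lift_ι]
    exact w.2

end Stalks

/-! ### Non-negative parts of subgroups of `ℚ` -/

theorem exists_nsmul_eq_and_nsmul_eq {H : AddSubgroup ℚ} (a b : nonnegPart H) :
    ∃ (c : nonnegPart H) (m n : ℕ), m • c = a ∧ n • c = b := by
  obtain ⟨a, ha, ha0⟩ := a
  obtain ⟨b, hb, hb0⟩ := b
  obtain ⟨d, hd, s, t, rfl, rfl⟩ : ∃ d : ℚ, 0 < d ∧ ∃ s t : ℕ, a = s * d ∧ b = t * d := by
    -- The inverse of a common denominator; it need not lie in `H`.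
    refine ⟨((a.den : ℚ) * b.den)⁻¹, by have := a.den_pos; have := b.den_pos; positivity,
      a.num.toNat * b.den, b.num.toNat * a.den, ?_, ?_⟩
    · have h : ((a.num.toNat : ℤ) : ℚ) = a.num := by
        rw [Int.toNat_of_nonneg (Rat.num_nonneg.2 ha0)]
      have ha := a.den_ne_zero
      have hb := b.den_ne_zero
      push_cast at h ⊢
      rw [h]
      nth_rw 1 [← Rat.num_div_den a]
      field_simp
    · have h : ((b.num.toNat : ℤ) : ℚ) = b.num := by
        rw [Int.toNat_of_nonneg (Rat.num_nonneg.2 hb0)]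
      have ha := a.den_ne_zero
      have hb := b.den_ne_zero
      push_cast at h ⊢
      rw [h]
      nth_rw 1 [← Rat.num_div_den b]
      field_simp
  -- By Bézout, `gcd(s, t) * d` is an integral combination of `a` and `b`, so it does lie in `H`.
  have hg : (s.gcd t : ℚ) * d = s.gcdA t • (s * d) + s.gcdB t • (t * d) := by
    have : ((s.gcd t : ℤ) : ℚ) = ((s * s.gcdA t + t * s.gcdB t : ℤ) : ℚ) := by
      rw [Nat.gcd_eq_gcd_ab]
    push_cast at this
    rw [this]
    simp only [zsmul_eq_mul]
    ring
  obtain ⟨m, hm⟩ := s.gcd_dvd_left t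
  obtain ⟨n, hn⟩ := s.gcd_dvd_right t
  refine ⟨⟨s.gcd t * d, ?_, by positivity⟩, m, n, Subtype.ext ?_, Subtype.ext ?_⟩
  · rw [hg]
    exact H.add_mem (H.zsmul_mem ha _) (H.zsmul_mem hb _)
  · change m • ((s.gcd t : ℚ) * d) = s * d
    conv_rhs => rw [hm]
    rw [nsmul_eq_mul]
    push_cast
    ring
  · change n • ((s.gcd t : ℚ) * d) = t * d
    conv_rhs => rw [hn]
    rw [nsmul_eq_mul]
    push_cast
    ring

instance isCofiltered_elements_nonnegFunctor (H : AddSubgroup ℚ) :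
    IsCofiltered (nonnegFunctor H).Elements where
  nonempty := ⟨⟨NZeroTimes.pt, (0 : nonnegPart H)⟩⟩
  cone_objs := by
    rintro ⟨_, a⟩ ⟨_, b⟩
    obtain ⟨c, m, n, hm, hn⟩ := exists_nsmul_eq_and_nsmul_eq (H := H) a b
    exact ⟨⟨NZeroTimes.pt, c⟩, ⟨m, hm⟩, ⟨n, hn⟩, trivial⟩
  cone_maps := by
    rintro ⟨_, a⟩ ⟨_, b⟩ ⟨(m : ℕ), (hm : m • (show nonnegPart H from a) = b)⟩
      ⟨(n : ℕ), (hn : n • (show nonnegPart H from a) = b)⟩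
    by_cases hmn : m = n
    · subst hmn
      exact ⟨_, 𝟙 _, rfl⟩
    · have ha : (show nonnegPart H from a) = 0 := by
        have h := congrArg Subtype.val (hm.trans hn.symm)
        change m • (Subtype.val (show nonnegPart H from a)) =
          n • (Subtype.val (show nonnegPart H from a)) at h
        rw [nsmul_eq_mul, nsmul_eq_mul, mul_eq_mul_right_iff] at h
        exact Subtype.ext (h.resolve_left fun h ↦ hmn (by exact_mod_cast h))
      -- Multiplication by `0`, available because the monoid contains `0`, equalizes any two
      -- morphisms.
      refine ⟨⟨NZeroTimes.pt, (0 : nonnegPart H)⟩, ⟨(0 : ℕ), ?_⟩, Subtype.ext ?_⟩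
      · exact (zero_nsmul (0 : nonnegPart H)).trans ha.symm
      · exact (Nat.mul_zero m).trans (Nat.mul_zero n).symm

/-! ### The stalks of the sheaf `𝒮` -/

theorem isClosed_singleton_of_ne_generic {x : SpecZ} (hx : x ≠ genericPointZ) :
    IsClosed ({x} : Set SpecZ) :=
  (PrimeSpectrum.isClosed_singleton_iff_isMaximal (R := ℤ) x).2
    (Ring.DimensionLEOne.maximalOfPrime (fun h ↦ hx (PrimeSpectrum.ext h)) x.2)

theorem isClosed_of_finite_of_generic_notMem {s : Set SpecZ} (hs : s.Finite)
    (hgen : genericPointZ ∉ s) : IsClosed s := by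
  rw [← Set.biUnion_of_singleton s]
  exact hs.isClosed_biUnion fun x hx ↦
    isClosed_singleton_of_ne_generic fun h ↦ hgen (h ▸ hx)

theorem nonnegPart_pointGroup_generic_eq_zero (q : nonnegPart (pointGroup genericPointZ)) :
    q = 0 := by
  have h : (q : ℚ) ∈ (⊥ : AddSubgroup ℚ) := pointGroup_generic.le q.2.1
  exact Subtype.ext (AddSubgroup.mem_bot.1 h)

/-- A finitely supported family vanishes on a punctured neighbourhood of every point. -/
theorem exists_openNhds_forall_eq_zero {x : SpecZ} (U : OpenNhds x)
    (ξ : ∀ y : U.1, nonnegPart (pointGroup y)) (hξ : finitelySupported.pred ξ) :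
    ∃ (W : OpenNhds x) (i : W ⟶ U), ∀ y : W.1, (y : SpecZ) ≠ x → ξ (i y : U.1) = 0 := by
  -- The points to remove: the support away from `x`. It is finite and avoids the generic point,
  -- where every value is `0`, so it is closed.
  let s : Set SpecZ := (fun y : U.1 ↦ (y : SpecZ)) '' {y : U.1 | ξ y ≠ 0 ∧ (y : SpecZ) ≠ x}
  have hs : IsClosed s := by
    refine isClosed_of_finite_of_generic_notMem
      ((Set.Finite.subset hξ fun y hy ↦ hy.1).image _) ?_
    rintro ⟨⟨y, hy⟩, ⟨h, -⟩, rfl⟩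
    exact h (nonnegPart_pointGroup_generic_eq_zero _)
  let V : Opens SpecZ := ⟨sᶜ, hs.isOpen_compl⟩
  have hxV : x ∈ V := by
    rintro ⟨y, ⟨-, h⟩, h'⟩
    exact h h'
  refine ⟨⟨U.1 ⊓ V, U.2, hxV⟩, homOfLE (inf_le_left (a := U.1)), fun y hy ↦ ?_⟩
  by_contra h
  exact y.2.2 ⟨⟨y, y.2.1⟩, ⟨h, hy⟩, rfl⟩

theorem stalkToFiber_finitelySupported_bijective (x : SpecZ) :
    Function.Bijective (TopCat.stalkToFiber finitelySupported x) := by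
  classical
  constructor
  -- Near `x` both sections vanish off `x`, so agreeing at `x` makes them equal there.
  · refine TopCat.stalkToFiber_injective _ x fun U V ξ hξ ζ hζ h ↦ ?_
    obtain ⟨W₁, i₁, h₁⟩ := exists_openNhds_forall_eq_zero U ξ hξ
    obtain ⟨W₂, i₂, h₂⟩ := exists_openNhds_forall_eq_zero V ζ hζ
    refine ⟨W₁ ⊓ W₂, homOfLE inf_le_left ≫ i₁, homOfLE inf_le_right ≫ i₂, ?_⟩
    rintro ⟨y, hy₁, hy₂⟩
    by_cases hy : y = x
    · subst hy
      exact h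
    · exact (h₁ ⟨y, hy₁⟩ hy).trans (h₂ ⟨y, hy₂⟩ hy).symm
  · refine TopCat.stalkToFiber_surjective _ x fun t ↦ ?_
    -- Extension by zero of `t` is a global section, with support contained in `{x}`.
    refine ⟨⟨⊤, trivial⟩, fun y ↦ Pi.single (M := fun y ↦ nonnegPart (pointGroup y)) x t y,
      ?_, Pi.single_eq_same (M := fun y ↦ nonnegPart (pointGroup y)) x t⟩
    refine (Set.finite_singleton (⟨x, trivial⟩ : (⊤ : Opens SpecZ))).subset fun y hy ↦ ?_
    by_contra h
    exact hy (Pi.single_eq_of_ne (M := fun y ↦ nonnegPart (pointGroup y))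
      (fun h' : (y : SpecZ) = x ↦ h (Subtype.ext h')) t)

/-- The stalk of `𝒮` at `x`, with its action of the non-negative integers, is `H(x)⁺`. -/
noncomputable def functorSCompStalkAtIso (x : SpecZ) :
    functorS ⋙ stalkAt x ≅ nonnegFunctor (pointGroup x) :=
  NatIso.ofComponents
    (fun _ ↦ (Equiv.ofBijective _ (stalkToFiber_finitelySupported_bijective x)).toIso) (by
      rintro ⟨⟩ ⟨⟩ (n : ℕ)
      refine TopCat.Presheaf.stalk_hom_ext _ fun U hx ↦ ?_
      ext ξ
      change TopCat.stalkToFiber finitelySupported x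
          ((TopCat.Presheaf.stalkFunctor Type x).map (mulS n).1
            (sheafS.presheaf.germ U x hx ξ)) =
        n • TopCat.stalkToFiber finitelySupported x (sheafS.presheaf.germ U x hx ξ)
      refine (congrArg (TopCat.stalkToFiber finitelySupported x)
        (TopCat.Presheaf.stalkFunctor_map_germ_apply U x hx (mulS n).1 ξ)).trans ?_
      exact (TopCat.stalkToFiber_germ finitelySupported U x hx _).trans
        (congrArg (n • ·) (TopCat.stalkToFiber_germ finitelySupported U x hx ξ).symm))

instance (x : SpecZ) : IsCofiltered (functorS ⋙ stalkAt x).Elements :=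
  isCofiltered_elements_of_iso (functorSCompStalkAtIso x).symm

theorem theorem4p3 :
    -- the stalk of the sheaf at every point `x` is the non-negative part of the group attached
    -- to `x`, via the value of sections at `x`, compatibly with the action
    (∀ x : SpecZ, ∃ e : functorS ⋙ stalkAt x ≅ nonnegFunctor (pointGroup x),
      e.hom.app NZeroTimes.pt = TopCat.stalkToFiber finitelySupported x) ∧
    -- the functor given by the sheaf and its action is filtering
    IsFiltering functorS ∧
    -- it is flat, and hence defines a geometric morphism `Θ`
    ∃ hS : IsFlat functorS,
      -- `Θ` is, up to isomorphism, the unique geometric morphism whose inverse image restricts to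
      -- the functor along the Yoneda embedding
      (∀ f : GeomMorphism (TopCat.Sheaf Type SpecZ) (NZeroTimesᵒᵖ ⥤ Type),
        Nonempty (uliftYoneda.{0} ⋙ f.inverseImage ≅ functorS) ↔
          f.Isomorphic (GeomMorphism.ofFlat functorS hS)) ∧
      -- the image of `p` is the point associated with `H(p)`
      (∀ p : Nat.Primes, ∃ hp : IsFlat (nonnegFunctor (fractionGroup p)),
        ((pointOfSpace (primePoint p)).comp (GeomMorphism.ofFlat functorS hS)).Isomorphic
          (GeomMorphism.ofFlat (nonnegFunctor (fractionGroup p)) hp)) ∧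
      -- the image of the generic point is the base point, associated with the trivial subgroup
      ∃ h0 : IsFlat (nonnegFunctor ⊥),
        ((pointOfSpace genericPointZ).comp (GeomMorphism.ofFlat functorS hS)).Isomorphic
          (GeomMorphism.ofFlat (nonnegFunctor ⊥) h0) := by
  have hS := isFlat_of_isCofiltered_elements_stalkAt functorS
  refine ⟨fun x ↦ ⟨functorSCompStalkAtIso x, rfl⟩,
    isFiltering_of_isCofiltered_elements_stalkAt functorS, hS,
    GeomMorphism.nonempty_iso_iff_isomorphic_ofFlat functorS hS,
    fun p ↦ ⟨isFlat_of_isCofiltered_elements _, ?_⟩, isFlat_of_isCofiltered_elements _, ?_⟩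
  · exact GeomMorphism.comp_ofFlat_isomorphic _ _ _
      (functorSCompStalkAtIso _ ≪≫ eqToIso (congrArg nonnegFunctor (pointGroup_prime p)))
  · exact GeomMorphism.comp_ofFlat_isomorphic _ _ _
      (functorSCompStalkAtIso _ ≪≫ eqToIso (congrArg nonnegFunctor pointGroup_generic))
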